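/- Theorem (Schramm). Let $n\ge 1$ and let $W\subset\mathbb R^n$ be a set of constant width, that is, a convex body (a compact convex set with non-empty interior) for which there is $w\in\mathbb R$ with $h_W(u)+h_W(-u)=w$ for every unit vector $u\in\mathbb R^n$, where $h_W(x)=\max\{\langle x,k\rangle : k\in W\}$ is the support function of $W$. Let the illumination number $i(W)$ be the minimum number of translates of the interior of $W$ whose union contains $W$. Then $i(W)$ is finite and $$i(W)\le 5n\sqrt n\,(4+\ln n)\left(\tfrac32\right)^{n/2}.$$ -/

import Mathlib

open scoped Pointwise

noncomputable section

namespace Illumination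

/-- Euclidean space of dimension `n`. -/
abbrev E (n : ℕ) : Type := EuclideanSpace ℝ (Fin n)

/-- The translative covering number of `K` by `L`: the minimum number of translates of `L`
whose union contains `K`; it is `⊤` if finitely many translates never suffice. -/
def coveringNumber {n : ℕ} (K L : Set (E n)) : ℕ∞ :=
  ⨅ (T : Set (E n)) (_ : K ⊆ ⋃ t ∈ T, t +ᵥ L), T.encard

/-- The illumination number of `K`: the minimum number of translates of the interior of `K`
that cover `K`. -/
def illuminationNumber {n : ℕ} (K : Set (E n)) : ℕ∞ :=
  coveringNumber K (interior K)

/-- A convex body: a compact convex set with non-empty interior. -/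
structure IsConvexBody {n : ℕ} (K : Set (E n)) : Prop where
  isCompact : IsCompact K
  convex : Convex ℝ K
  interior_nonempty : (interior K).Nonempty

/-- The support function of `K` (used for non-empty bounded `K` only). -/
def supportFunction {n : ℕ} (K : Set (E n)) (x : E n) : ℝ :=
  sSup ((fun k : E n => inner ℝ x k) '' K)

/-- The width of `K` in direction `u`: for a unit vector `u`, the distance of the two
hyperplanes orthogonal to `u` that support `K`. -/
def width {n : ℕ} (K : Set (E n)) (u : E n) : ℝ :=
  supportFunction K u + supportFunction K (-u)

/-- A set of constant width: a convex body that has the same width in all directions. -/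
structure IsConstantWidth {n : ℕ} (K : Set (E n)) : Prop where
  isConvexBody : IsConvexBody K
  exists_width_eq : ∃ w : ℝ, ∀ u : E n, ‖u‖ = 1 → width K u = w

end Illumination

end

/-!
If `W` has constant width `w`, then for every unit outer normal `u` at a point `x` of `W` the
antipodal point `x - w • u` lies in `W` too. As `W` has diameter `w`, the normals at points within
distance `w * ρ` of each other therefore lie within distance `1 + ρ` of each other, and for
small `ρ` all of them make an angle of cosine at least about `√(1 / 2)` with one unit vector `c`.
For `y` in a circular cone around `c` whose half-angle has sine about `√(2 / 3)`, either `y` or its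
reflection in the line of `c` has positive inner product with all these normals: otherwise two
normals would be too far apart. Hence the directions that illuminate the given part of `W` fill a
proportion of order `(2 / 3) ^ (n / 2) / √n` of the unit ball. Covering `W` by `exp (O(n log n))`
small balls and choosing directions greedily, so that each hits the dual cones of at least this
proportion of the balls still missed, gives the bound.
-/

namespace Illumination

open MeasureTheory Metric Module
open scoped InnerProductSpace

section Normals

variable {V : Type*} [NormedAddCommGroup V] [InnerProductSpace ℝ V] {K Y : Set V} {x y v : V}

/-- The unit outer normals of `K` at `x`. -/
def outerNormals (K : Set V) (x : V) : Set V :=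
  {u | ‖u‖ = 1 ∧ ∀ k ∈ K, ⟪u, k⟫_ℝ ≤ ⟪u, x⟫_ℝ}

/-- The directions in `Y` illuminate `K`: at every point of `K` some direction in `Y` points
strictly to the inner side of all supporting hyperplanes. Interior points have no outer normals, so
only the boundary of `K` matters. -/
def Illuminates (Y K : Set V) : Prop :=
  ∀ x ∈ K, ∃ y ∈ Y, ∀ u ∈ outerNormals K x, ⟪u, y⟫_ℝ < 0

lemma inv_norm_smul_mem_outerNormals (hv : v ≠ 0) (h : ∀ k ∈ K, ⟪v, k⟫_ℝ ≤ ⟪v, x⟫_ℝ) :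
    ‖v‖⁻¹ • v ∈ outerNormals K x := by
  refine ⟨norm_smul_inv_norm hv, fun k hk => ?_⟩
  rw [real_inner_smul_left, real_inner_smul_left]
  exact mul_le_mul_of_nonneg_left (h k hk) (by positivity)

lemma convex_openRay (x y : V) : Convex ℝ {z | ∃ ε : ℝ, 0 < ε ∧ z = x + ε • y} := by
  convert ((convex_Ioi (0 : ℝ)).linear_image (LinearMap.toSpanSingleton ℝ V y)).translate x
    using 1
  ext z
  simp only [Set.mem_ofPred_eq, Set.mem_image, Set.image_image, LinearMap.toSpanSingleton_apply,
    Set.mem_Ioi, eq_comm]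

lemma exists_outerNormal_inner_nonneg [CompleteSpace V] (hK : Convex ℝ K)
    (hne : (interior K).Nonempty) (hx : x ∈ K)
    (hray : ∀ ε : ℝ, 0 < ε → x + ε • y ∉ interior K) :
    ∃ u ∈ outerNormals K x, 0 ≤ ⟪u, y⟫_ℝ := by
  have hdisj : Disjoint (interior K) {z | ∃ ε : ℝ, 0 < ε ∧ z = x + ε • y} := by
    rw [Set.disjoint_right]
    rintro _ ⟨ε, hε, rfl⟩
    exact hray ε hε
  obtain ⟨f, s, hlt, hle⟩ := geometric_hahn_banach_open hK.interior isOpen_interior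
    (convex_openRay x y) hdisj
  have hle_s : ∀ k ∈ K, f k ≤ s := by
    have hsub : closure (interior K) ⊆ {k | f k ≤ s} :=
      closure_minimal (fun a ha => (hlt a ha).le) (isClosed_le f.continuous continuous_const)
    rw [hK.closure_interior_eq_closure_of_nonempty_interior hne] at hsub
    exact fun k hk => hsub (subset_closure hk)
  have hs_ray : ∀ ε : ℝ, 0 < ε → s ≤ f x + ε * f y := fun ε hε => by
    simpa using hle _ ⟨ε, hε, rfl⟩
  have hs_le : s ≤ f x := by
    have hlim : Filter.Tendsto (fun ε : ℝ => f x + ε * f y) (nhdsWithin 0 (Set.Ioi 0))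
        (nhds (f x)) := by
      have hcont : Continuous fun ε : ℝ => f x + ε * f y := by fun_prop
      simpa using (hcont.tendsto 0).mono_left nhdsWithin_le_nhds
    exact ge_of_tendsto hlim (by filter_upwards [self_mem_nhdsWithin] using hs_ray)
  set v : V := (InnerProductSpace.toDual ℝ V).symm f
  have hvf : ∀ z, ⟪v, z⟫_ℝ = f z := fun z => InnerProductSpace.toDual_symm_apply
  have hv0 : v ≠ 0 := by
    intro h0
    obtain ⟨a, ha⟩ := hne
    have := (hlt a ha).trans_le hs_le
    simp [← hvf, h0] at this
  refine ⟨_, inv_norm_smul_mem_outerNormals hv0 fun k hk => ?_, ?_⟩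
  · rw [hvf, hvf]
    exact (hle_s k hk).trans hs_le
  · rw [real_inner_smul_left, hvf]
    have : 0 ≤ f y := by linarith [hs_ray 1 one_pos, hle_s x hx]
    positivity

lemma add_smul_mem_interior_of_le {ε δ : ℝ} (hK : Convex ℝ K) (hx : x ∈ K) (hδ : 0 < δ)
    (hδε : δ ≤ ε) (h : x + ε • y ∈ interior K) : x + δ • y ∈ interior K := by
  have hε : 0 < ε := hδ.trans_le hδε
  have := hK.add_smul_mem_interior hx h ⟨div_pos hδ hε, (div_le_one hε).2 hδε⟩
  rwa [smul_smul, div_mul_cancel₀ _ hε.ne'] at this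

lemma exists_uniform_step_mem_interior (hcomp : IsCompact K) (hK : Convex ℝ K)
    (h : ∀ x ∈ K, ∃ y ∈ Y, ∃ ε : ℝ, 0 < ε ∧ x + ε • y ∈ interior K) :
    ∃ ε : ℝ, 0 < ε ∧ ∀ x ∈ K, ∃ y ∈ Y, x + ε • y ∈ interior K := by
  suffices ∃ ε : ℝ, 0 < ε ∧ ∀ x ∈ K, x ∈ K → ∃ y ∈ Y, x + ε • y ∈ interior K by
    simpa using this
  refine hcomp.induction_on
    (p := fun s => ∃ ε : ℝ, 0 < ε ∧ ∀ x ∈ s, x ∈ K → ∃ y ∈ Y, x + ε • y ∈ interior K)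
    ⟨1, one_pos, by simp⟩ ?_ ?_ ?_
  · rintro s t hst ⟨ε, hε, ht⟩
    exact ⟨ε, hε, fun x hx => ht x (hst hx)⟩
  · rintro s t ⟨ε, hε, hs⟩ ⟨δ, hδ, ht⟩
    refine ⟨min ε δ, lt_min hε hδ, ?_⟩
    rintro x (hx | hx) hxK
    · obtain ⟨y, hy, hxy⟩ := hs x hx hxK
      exact ⟨y, hy, add_smul_mem_interior_of_le hK hxK (lt_min hε hδ) (min_le_left _ _) hxy⟩
    · obtain ⟨y, hy, hxy⟩ := ht x hx hxK
      exact ⟨y, hy, add_smul_mem_interior_of_le hK hxK (lt_min hε hδ) (min_le_right _ _) hxy⟩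
  · intro x hx
    obtain ⟨y, hy, ε, hε, hxy⟩ := h x hx
    have hopen : IsOpen {z | z + ε • y ∈ interior K} := isOpen_interior.preimage (by fun_prop)
    exact ⟨_, mem_nhdsWithin_of_mem_nhds (hopen.mem_nhds hxy), ε, hε, fun z hz _ => ⟨y, hy, hz⟩⟩

lemma eq_smul_of_inner_eq_of_norm_le {u : V} {w : ℝ} (hu : ‖u‖ = 1)
    (hinner : ⟪u, y⟫_ℝ = w) (hnorm : ‖y‖ ≤ w) : y = w • u := by
  have hsq : ‖y - w • u‖ ^ 2 ≤ 0 := by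
    rw [norm_sub_sq_real, real_inner_smul_right, real_inner_comm, hinner, norm_smul, hu, mul_one,
      Real.norm_eq_abs, sq_abs]
    nlinarith [norm_nonneg y]
  exact sub_eq_zero.1 (norm_eq_zero.1 (pow_eq_zero_iff two_ne_zero |>.1
    (hsq.antisymm (sq_nonneg _))))

end Normals

section Width

variable {n : ℕ} {K : Set (E n)} {u x : E n} {w : ℝ}

lemma IsConvexBody.nonempty (hK : IsConvexBody K) : K.Nonempty :=
  hK.interior_nonempty.mono interior_subset

lemma IsConvexBody.illuminationNumber_le_encard (hK : IsConvexBody K) {Y : Set (E n)}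
    (hY : Illuminates Y K) : illuminationNumber K ≤ Y.encard := by
  obtain ⟨ε, -, hε⟩ := exists_uniform_step_mem_interior (Y := Y) hK.isCompact hK.convex
    fun x hx => by
      obtain ⟨y, hy, hneg⟩ := hY x hx
      refine ⟨y, hy, ?_⟩
      by_contra! hray
      obtain ⟨u, hu, hnonneg⟩ :=
        exists_outerNormal_inner_nonneg hK.convex hK.interior_nonempty hx hray
      exact (hneg u hu).not_ge hnonneg
  have hcover : K ⊆ ⋃ t ∈ (fun y => -(ε • y)) '' Y, t +ᵥ interior K := fun x hx => by
    obtain ⟨y, hy, hxy⟩ := hε x hx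
    exact Set.mem_biUnion (Set.mem_image_of_mem _ hy) ⟨_, hxy, by simp⟩
  have hle := iInf₂_le (f := fun (T : Set (E n)) (_ : K ⊆ ⋃ t ∈ T, t +ᵥ interior K) => T.encard)
    _ hcover
  exact hle.trans (Set.encard_image_le _ _)

lemma IsConvexBody.inner_le_supportFunction (hK : IsConvexBody K) (u : E n) (hx : x ∈ K) :
    ⟪u, x⟫_ℝ ≤ supportFunction K u :=
  le_csSup (hK.isCompact.image (by fun_prop)).bddAbove (Set.mem_image_of_mem _ hx)

lemma IsConvexBody.exists_inner_eq_supportFunction (hK : IsConvexBody K) (u : E n) :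
    ∃ k ∈ K, ⟪u, k⟫_ℝ = supportFunction K u :=
  (hK.isCompact.image (by fun_prop)).sSup_mem (hK.nonempty.image _)

lemma IsConvexBody.inner_sub_le_width (hK : IsConvexBody K) (u : E n) {a b : E n} (ha : a ∈ K)
    (hb : b ∈ K) : ⟪u, a - b⟫_ℝ ≤ width K u := by
  have hneg := hK.inner_le_supportFunction (-u) hb
  rw [inner_neg_left] at hneg
  rw [inner_sub_right, width]
  linarith [hK.inner_le_supportFunction u ha]

lemma IsConvexBody.width_pos (hK : IsConvexBody K) (hu : u ≠ 0) : 0 < width K u := by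
  obtain ⟨a, ha⟩ := hK.interior_nonempty
  obtain ⟨ε, hε, hball⟩ := Metric.isOpen_iff.1 isOpen_interior a ha
  have : 0 < ‖u‖ := norm_pos_iff.2 hu
  have hmem : a + (ε / (2 * ‖u‖)) • u ∈ K := by
    refine interior_subset (hball ?_)
    rw [mem_ball_iff_norm, add_sub_cancel_left, norm_smul, Real.norm_of_nonneg (by positivity)]
    field_simp
    linarith
  refine lt_of_lt_of_le ?_ (hK.inner_sub_le_width u hmem (interior_subset ha))
  rw [add_sub_cancel_left, real_inner_smul_right, real_inner_self_eq_norm_sq]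
  positivity

lemma IsConvexBody.norm_sub_le (hK : IsConvexBody K) (hw0 : 0 ≤ w)
    (hw : ∀ u : E n, ‖u‖ = 1 → width K u ≤ w) {a b : E n} (ha : a ∈ K) (hb : b ∈ K) :
    ‖a - b‖ ≤ w := by
  rcases eq_or_ne a b with rfl | hab
  · simpa using hw0
  · have hpos : ‖a - b‖ ≠ 0 := norm_ne_zero_iff.2 (sub_ne_zero.2 hab)
    calc ‖a - b‖ = ⟪‖a - b‖⁻¹ • (a - b), a - b⟫_ℝ := by
          rw [real_inner_smul_left, real_inner_self_eq_norm_sq]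
          field_simp
      _ ≤ width K (‖a - b‖⁻¹ • (a - b)) := hK.inner_sub_le_width _ ha hb
      _ ≤ w := hw _ (norm_smul_inv_norm (sub_ne_zero.2 hab))

lemma IsConvexBody.sub_smul_mem (hK : IsConvexBody K) (hw0 : 0 ≤ w)
    (hw : ∀ u : E n, ‖u‖ = 1 → width K u = w) (hx : x ∈ K) (hu : u ∈ outerNormals K x) :
    x - w • u ∈ K := by
  obtain ⟨a, ha, hau⟩ := hK.exists_inner_eq_supportFunction u
  obtain ⟨z, hz, hzu⟩ := hK.exists_inner_eq_supportFunction (-u)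
  have hsupp : supportFunction K u = ⟪u, x⟫_ℝ :=
    le_antisymm (hau ▸ hu.2 a ha) (hK.inner_le_supportFunction u hx)
  have hxz : ⟪u, x - z⟫_ℝ = w := by
    rw [← hw u hu.1, width, hsupp, ← hzu, inner_neg_left, inner_sub_right, sub_eq_add_neg]
  have hdiam : ‖x - z‖ ≤ w := hK.norm_sub_le hw0 (fun v hv => (hw v hv).le) hx hz
  rwa [← eq_smul_of_inner_eq_of_norm_le hu.1 hxz hdiam, sub_sub_cancel]

lemma IsConstantWidth.exists_diameter [NeZero n] (hK : IsConstantWidth K) :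
    ∃ w : ℝ, 0 < w ∧ (∀ a ∈ K, ∀ b ∈ K, ‖a - b‖ ≤ w) ∧
      ∀ x ∈ K, ∀ u ∈ outerNormals K x, x - w • u ∈ K := by
  obtain ⟨hbody, w, hw⟩ := hK
  obtain ⟨e, he⟩ := exists_norm_eq (E n) zero_le_one
  have hw0 : 0 < w := hw e he ▸ hbody.width_pos (norm_ne_zero_iff.1 (by simp [he]))
  exact ⟨w, hw0, fun a ha b hb => hbody.norm_sub_le hw0.le (fun u hu => (hw u hu).le) ha hb,
    fun x hx u hu => hbody.sub_smul_mem hw0.le hw hx hu⟩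

end Width

section NormalsNear

variable {V : Type*} [NormedAddCommGroup V] [InnerProductSpace ℝ V] {K : Set V} {s u₁ u₂ : V}
  {w ρ : ℝ}

/-- The unit outer normals of `K` at the points of `K` within distance `ρ` of `s`. -/
def normalsNear (K : Set V) (s : V) (ρ : ℝ) : Set V :=
  {u | ∃ x ∈ K, dist x s ≤ ρ ∧ u ∈ outerNormals K x}

lemma norm_eq_one_of_mem_normalsNear (hu : u₁ ∈ normalsNear K s ρ) : ‖u₁‖ = 1 := by
  obtain ⟨_, _, _, hu⟩ := hu
  exact hu.1

lemma norm_sub_le_of_mem_normalsNear (hw : 0 < w) (hdiam : ∀ a ∈ K, ∀ b ∈ K, ‖a - b‖ ≤ w)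
    (hopp : ∀ x ∈ K, ∀ u ∈ outerNormals K x, x - w • u ∈ K) (hu₁ : u₁ ∈ normalsNear K s (w * ρ))
    (hu₂ : u₂ ∈ normalsNear K s (w * ρ)) : ‖u₁ - u₂‖ ≤ 1 + 2 * ρ := by
  obtain ⟨x₁, hx₁, hs₁, hn₁⟩ := hu₁
  obtain ⟨x₂, hx₂, hs₂, hn₂⟩ := hu₂
  have hx : ‖x₁ - x₂‖ ≤ w * ρ + w * ρ := by
    rw [← dist_eq_norm]
    exact (dist_triangle_right x₁ x₂ s).trans (add_le_add hs₁ hs₂)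
  refine le_of_mul_le_mul_left ?_ hw
  calc w * ‖u₁ - u₂‖ = ‖(x₁ - x₂) - ((x₁ - w • u₁) - (x₂ - w • u₂))‖ := by
        rw [← Real.norm_of_nonneg hw.le, ← norm_smul, Real.norm_of_nonneg hw.le, smul_sub]
        congr 1
        abel
    _ ≤ ‖x₁ - x₂‖ + ‖(x₁ - w • u₁) - (x₂ - w • u₂)‖ := norm_sub_le _ _
    _ ≤ (w * ρ + w * ρ) + w := add_le_add hx (hdiam _ (hopp _ hx₁ _ hn₁) _ (hopp _ hx₂ _ hn₂))
    _ = w * (1 + 2 * ρ) := by ring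

end NormalsNear

section Center

variable {V : Type*} [NormedAddCommGroup V] [InnerProductSpace ℝ V] {X : Set V} {u v : V} {b D : ℝ}

lemma le_inner_of_norm_sub_le (hu : ‖u‖ = 1) (hv : ‖v‖ = 1) (h : ‖u - v‖ ≤ D) :
    1 - D ^ 2 / 2 ≤ ⟪u, v⟫_ℝ := by
  have hsq := norm_sub_sq_real u v
  rw [hu, hv] at hsq
  linarith [pow_le_pow_left₀ (norm_nonneg _) h 2]

lemma le_inner_of_mem_closure_convexHull (h : ∀ u ∈ X, b ≤ ⟪v, u⟫_ℝ)
    (hu : u ∈ closure (convexHull ℝ X)) : b ≤ ⟪v, u⟫_ℝ := by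
  have hconv : Convex ℝ {a : V | b ≤ ⟪v, a⟫_ℝ} := convex_halfSpace_ge (innerₛₗ ℝ v).isLinear _
  have hclosed : IsClosed {a : V | b ≤ ⟪v, a⟫_ℝ} := isClosed_le (by fun_prop) (by fun_prop)
  exact closure_minimal (convexHull_min h hconv) hclosed hu

lemma exists_unit_sqrt_le_inner [CompleteSpace V] [Nontrivial V] (hb : 0 < b)
    (hX : ∀ u ∈ X, ∀ v ∈ X, b ≤ ⟪u, v⟫_ℝ) :
    ∃ c : V, ‖c‖ = 1 ∧ ∀ u ∈ X, √b ≤ ⟪c, u⟫_ℝ := by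
  rcases X.eq_empty_or_nonempty with rfl | hne
  · obtain ⟨c, hc⟩ := exists_norm_eq V zero_le_one
    exact ⟨c, hc, by simp⟩
  set H := closure (convexHull ℝ X)
  have hsub : X ⊆ H := (subset_convexHull ℝ X).trans subset_closure
  have hinner : ∀ p ∈ H, ∀ q ∈ H, b ≤ ⟪p, q⟫_ℝ := fun p hp q hq =>
    le_inner_of_mem_closure_convexHull (fun u hu => by
      rw [real_inner_comm]
      exact le_inner_of_mem_closure_convexHull (hX u hu) hp) hq
  have hconv : Convex ℝ H := (convex_convexHull ℝ X).closure
  -- The point of `H` nearest to the origin points in the required direction.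
  obtain ⟨p, hp, hmin⟩ := exists_norm_eq_iInf_of_complete_convex (hne.mono hsub)
    isClosed_closure.isComplete hconv 0
  rw [norm_eq_iInf_iff_real_inner_le_zero hconv hp] at hmin
  have hpb : √b ≤ ‖p‖ := Real.sqrt_le_iff.2
    ⟨norm_nonneg p, real_inner_self_eq_norm_sq p ▸ hinner p hp p hp⟩
  have hp0 : 0 < ‖p‖ := (Real.sqrt_pos.2 hb).trans_le hpb
  refine ⟨‖p‖⁻¹ • p, norm_smul_inv_norm (norm_pos_iff.1 hp0), fun u hu => ?_⟩
  have hpu := hmin u (hsub hu)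
  rw [zero_sub, inner_neg_left, inner_sub_right, real_inner_self_eq_norm_sq] at hpu
  rw [real_inner_smul_left, inv_mul_eq_div, le_div_iff₀ hp0]
  nlinarith

end Center

section DualCone

variable {V : Type*} [NormedAddCommGroup V] [InnerProductSpace ℝ V] {X : Set V} {c y z : V}
  {a h r t D : ℝ}

/-- The strict dual cone of `X`: the vectors whose inner products with the elements of `X` are
bounded below by a positive constant. -/
def strictDualCone (X : Set V) : Set V :=
  {y | ∃ ε : ℝ, 0 < ε ∧ ∀ u ∈ X, ε ≤ ⟪u, y⟫_ℝ}

lemma measurableSet_strictDualCone [MeasurableSpace V] [BorelSpace V] (X : Set V) :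
    MeasurableSet (strictDualCone X) := by
  have hUnion : strictDualCone X = ⋃ k : ℕ, ⋂ u ∈ X, {y : V | 1 / ((k : ℝ) + 1) ≤ ⟪u, y⟫_ℝ} := by
    ext y
    simp only [strictDualCone, Set.mem_ofPred_eq, Set.mem_iUnion, Set.mem_iInter]
    constructor
    · rintro ⟨ε, hε, h⟩
      obtain ⟨k, hk⟩ := exists_nat_one_div_lt hε
      exact ⟨k, fun u hu => hk.le.trans (h u hu)⟩
    · rintro ⟨k, h⟩
      exact ⟨_, by positivity, h⟩
  rw [hUnion]
  exact MeasurableSet.iUnion fun k => (isClosed_biInter fun u _ =>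
    isClosed_le (by fun_prop) (by fun_prop)).measurableSet

/-- The open circular cone around the unit vector `c` whose half-angle has cosine `h`. -/
def circularCone (c : V) (h : ℝ) : Set V :=
  {y | h * ‖y‖ < ⟪c, y⟫_ℝ}

lemma isOpen_circularCone (c : V) (h : ℝ) : IsOpen (circularCone c h) :=
  isOpen_lt (by fun_prop) (by fun_prop)

lemma norm_smul_add_sq (hc : ‖c‖ = 1) (hz : ⟪c, z⟫_ℝ = 0) (t : ℝ) :
    ‖t • c + z‖ ^ 2 = t ^ 2 + ‖z‖ ^ 2 := by
  rw [norm_add_sq_real, norm_smul, hc, real_inner_smul_left, hz, mul_one, Real.norm_eq_abs, sq_abs]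
  ring

lemma smul_add_mem_circularCone_iff (hc : ‖c‖ = 1) (hz : ⟪c, z⟫_ℝ = 0) (hh : 0 < h) (hr : 0 < r)
    (hhr : h ^ 2 + r ^ 2 = 1) : t • c + z ∈ circularCone c h ↔ h * ‖z‖ < r * t := by
  have hinner : ⟪c, t • c + z⟫_ℝ = t := by
    rw [inner_add_right, real_inner_smul_right, real_inner_self_eq_norm_sq, hc, hz]
    ring
  have hnorm := norm_smul_add_sq hc hz t
  rw [circularCone, Set.mem_ofPred_eq, hinner]
  constructor <;> intro hlt
  · have ht : 0 < t := hlt.trans_le' (by positivity)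
    have hsq := pow_lt_pow_left₀ hlt (by positivity) two_ne_zero
    refine lt_of_pow_lt_pow_left₀ 2 (by positivity) ?_
    rw [mul_pow, hnorm] at hsq
    nlinarith
  · have ht : 0 < t := pos_of_mul_pos_right (hlt.trans_le' (by positivity)) hr.le
    have hsq := pow_lt_pow_left₀ hlt (by positivity) two_ne_zero
    refine lt_of_pow_lt_pow_left₀ 2 ht.le ?_
    rw [mul_pow, hnorm]
    nlinarith

lemma reflection_smul_add (hc : ‖c‖ = 1) (hz : ⟪c, z⟫_ℝ = 0) (t : ℝ) :
    (ℝ ∙ c).reflection (t • c + z) = t • c - z := by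
  rw [Submodule.reflection_apply, Submodule.starProjection_unit_singleton ℝ hc, inner_add_right,
    real_inner_smul_right, real_inner_self_eq_norm_sq, hc, hz, one_pow, mul_one, add_zero, two_smul]
  abel

/-- If neither vector belongs to the dual cone, then some `u, v ∈ X` satisfy
`⟪u, z⟫ ≤ -a * t` and `⟪v, z⟫ ≥ a * t` up to an error, hence `‖u - v‖ * ‖z‖ ≥ 2 * a * t`. -/
lemma smul_add_mem_strictDualCone_or (hXD : ∀ u ∈ X, ∀ v ∈ X, ‖u - v‖ ≤ D)
    (ha : ∀ u ∈ X, a ≤ ⟪c, u⟫_ℝ) (ht : 0 ≤ t) (hlt : D * ‖z‖ < 2 * a * t) :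
    t • c + z ∈ strictDualCone X ∨ t • c - z ∈ strictDualCone X := by
  have hε : 0 < (2 * a * t - D * ‖z‖) / 2 := by linarith
  by_contra! hcon
  simp only [strictDualCone, Set.mem_ofPred_eq, not_exists, not_and, not_forall, not_le] at hcon
  obtain ⟨⟨u, hu, huy⟩, v, hv, hvy⟩ := hcon.imp (· _ hε) (· _ hε)
  rw [inner_add_right, real_inner_smul_right, real_inner_comm] at huy
  rw [inner_sub_right, real_inner_smul_right, real_inner_comm] at hvy
  have hvu : ⟪v - u, z⟫_ℝ ≤ D * ‖z‖ := (real_inner_le_norm _ _).trans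
    (mul_le_mul_of_nonneg_right (hXD v hv u hu) (norm_nonneg z))
  rw [inner_sub_left] at hvu
  linarith [mul_le_mul_of_nonneg_left (ha u hu) ht, mul_le_mul_of_nonneg_left (ha v hv) ht]

/-- The cosine of the half-angle of the circular cone associated with a set of unit vectors of
diameter `D < √2`. The tangent of the half-angle is `2 * √(1 - D ^ 2 / 2) / D`, the supremum of the
ratios `‖z‖ / t` allowed in `smul_add_mem_strictDualCone_or`. -/
noncomputable def coneCos (D : ℝ) : ℝ := D / √(4 - D ^ 2)

/-- The sine of the half-angle with cosine `coneCos D`. -/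
noncomputable def coneSin (D : ℝ) : ℝ := √(4 - 2 * D ^ 2) / √(4 - D ^ 2)

lemma coneCos_pos (hD0 : 0 < D) (hD : D ^ 2 < 2) : 0 < coneCos D :=
  div_pos hD0 (Real.sqrt_pos.2 (by linarith))

lemma coneSin_pos (hD : D ^ 2 < 2) : 0 < coneSin D :=
  div_pos (Real.sqrt_pos.2 (by linarith)) (Real.sqrt_pos.2 (by linarith))

lemma coneCos_sq_add_coneSin_sq (hD : D ^ 2 < 2) : coneCos D ^ 2 + coneSin D ^ 2 = 1 := by
  rw [coneCos, coneSin, div_pow, div_pow, Real.sq_sqrt (by linarith), Real.sq_sqrt (by linarith)]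
  have : 4 - D ^ 2 ≠ 0 := by linarith
  field_simp
  ring

lemma mem_strictDualCone_or_reflection_mem (hc : ‖c‖ = 1) (hD0 : 0 < D) (hD : D ^ 2 < 2)
    (hXD : ∀ u ∈ X, ∀ v ∈ X, ‖u - v‖ ≤ D) (hcX : ∀ u ∈ X, √(1 - D ^ 2 / 2) ≤ ⟪c, u⟫_ℝ)
    (hy : y ∈ circularCone c (coneCos D)) :
    y ∈ strictDualCone X ∨ (ℝ ∙ c).reflection y ∈ strictDualCone X := by
  obtain ⟨t, z, hz, rfl⟩ : ∃ (t : ℝ) (z : V), ⟪c, z⟫_ℝ = 0 ∧ t • c + z = y :=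
    ⟨⟪c, y⟫_ℝ, y - ⟪c, y⟫_ℝ • c, by
      rw [inner_sub_right, real_inner_smul_right, real_inner_self_eq_norm_sq, hc]; ring, by abel⟩
  rw [smul_add_mem_circularCone_iff hc hz (coneCos_pos hD0 hD) (coneSin_pos hD)
    (coneCos_sq_add_coneSin_sq hD), coneCos, coneSin, div_mul_eq_mul_div, div_mul_eq_mul_div,
    div_lt_div_iff_of_pos_right (Real.sqrt_pos.2 (by linarith))] at hy
  have hsqrt : √(4 - 2 * D ^ 2) = 2 * √(1 - D ^ 2 / 2) := by
    rw [show 4 - 2 * D ^ 2 = 2 ^ 2 * (1 - D ^ 2 / 2) by ring, Real.sqrt_mul (by norm_num),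
      Real.sqrt_sq (by norm_num)]
  have ht : 0 ≤ t := (pos_of_mul_pos_right (hy.trans_le' (by positivity)) (by positivity)).le
  rw [reflection_smul_add hc hz]
  exact smul_add_mem_strictDualCone_or hXD hcX ht (hsqrt ▸ hy)

end DualCone

section ConeVolume

variable {V : Type*} [NormedAddCommGroup V] [InnerProductSpace ℝ V] {c : V} {h r : ℝ} {m : ℕ}

lemma smul_add_mem_circularCone_inter_ball_iff (hc : ‖c‖ = 1) (hh : 0 < h) (hr : 0 < r)
    (hhr : h ^ 2 + r ^ 2 = 1) {t : ℝ} {z : (ℝ ∙ c)ᗮ} :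
    t • c + (z : V) ∈ circularCone c h ∩ ball 0 1 ↔ h * ‖z‖ < r * t ∧ t ^ 2 + ‖z‖ ^ 2 < 1 := by
  have hz : ⟪c, z⟫_ℝ = 0 := Submodule.mem_orthogonal_singleton_iff_inner_right.1 z.2
  rw [Set.mem_inter_iff, smul_add_mem_circularCone_iff hc hz hh hr hhr, mem_ball_zero_iff,
    ← sq_lt_one_iff₀ (norm_nonneg _), norm_smul_add_sq hc hz, Submodule.coe_norm]

lemma ball_subset_slice_of_lt (hc : ‖c‖ = 1) (hr : 0 < r) (hhr : h ^ 2 + r ^ 2 = 1) {t : ℝ}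
    (ht : t ∈ Set.Ioo 0 h) :
    ball (0 : (ℝ ∙ c)ᗮ) (r * t / h) ⊆ {z | t • c + (z : V) ∈ circularCone c h ∩ ball 0 1} := by
  intro z hz
  obtain ⟨ht0, hth⟩ := ht
  have hh : 0 < h := ht0.trans hth
  rw [mem_ball_zero_iff, lt_div_iff₀ hh] at hz
  have hzr : ‖z‖ < r := lt_of_mul_lt_mul_right (hz.trans (by gcongr)) hh.le
  refine (smul_add_mem_circularCone_inter_ball_iff hc hh hr hhr).2 ⟨by linarith, ?_⟩
  calc t ^ 2 + ‖z‖ ^ 2 < h ^ 2 + r ^ 2 := by gcongr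
    _ = 1 := hhr

lemma ball_subset_slice_of_gt (hc : ‖c‖ = 1) (hh : 0 < h) (hr : 0 < r) (hhr : h ^ 2 + r ^ 2 = 1)
    {t : ℝ} (ht : h < t) :
    ball (0 : (ℝ ∙ c)ᗮ) √(1 - t ^ 2) ⊆ {z | t • c + (z : V) ∈ circularCone c h ∩ ball 0 1} := by
  intro z hz
  rw [mem_ball_zero_iff, Real.lt_sqrt (norm_nonneg z)] at hz
  have hzr : ‖z‖ < r := lt_of_pow_lt_pow_left₀ 2 hr.le (by nlinarith)
  refine (smul_add_mem_circularCone_inter_ball_iff hc hh hr hhr).2 ⟨?_, by linarith⟩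
  calc h * ‖z‖ < h * r := by gcongr
    _ < r * t := by rw [mul_comm]; gcongr

variable [FiniteDimensional ℝ V] [MeasurableSpace V] [BorelSpace V]

lemma measurePreserving_smul_add (hc : ‖c‖ = 1) :
    MeasurePreserving fun p : ℝ × (ℝ ∙ c)ᗮ => p.1 • c + (p.2 : V) := by
  have hspan : MeasurePreserving (LinearIsometryEquiv.toSpanUnitSingleton (𝕜 := ℝ) c hc) :=
    LinearIsometryEquiv.measurePreserving _
  have hprod := hspan.prod (MeasurePreserving.id (volume : Measure (ℝ ∙ c)ᗮ))
  have hlp := (ℝ ∙ c).orthogonalDecomposition.symm.measurePreserving.comp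
    (WithLp.volume_preserving_toLp (ℝ ∙ c) (ℝ ∙ c)ᗮ)
  exact hlp.comp hprod

lemma volume_eq_lintegral_slice (hc : ‖c‖ = 1) {S : Set V} (hS : MeasurableSet S) :
    volume S = ∫⁻ t : ℝ, volume {z : (ℝ ∙ c)ᗮ | t • c + (z : V) ∈ S} := by
  have hmp := measurePreserving_smul_add hc
  rw [← hmp.measure_preimage hS.nullMeasurableSet, Measure.volume_eq_prod,
    Measure.prod_apply (hmp.measurable hS)]
  rfl

lemma ofReal_integral_mul_le_setLIntegral {a b : ℝ} (hab : a ≤ b) {f : ℝ → ℝ} {g : ℝ → ENNReal}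
    {v : ENNReal} (hf : Continuous f) (hf0 : ∀ t ∈ Set.Ioo a b, 0 ≤ f t)
    (hfg : ∀ t ∈ Set.Ioo a b, ENNReal.ofReal (f t) * v ≤ g t) :
    ENNReal.ofReal (∫ t in a..b, f t) * v ≤ ∫⁻ t in Set.Ioo a b, g t := by
  have hint : IntegrableOn f (Set.Ioo a b) := hf.integrableOn_Icc.mono_set Set.Ioo_subset_Icc_self
  have hnonneg : 0 ≤ᵐ[volume.restrict (Set.Ioo a b)] f := by
    filter_upwards [ae_restrict_mem measurableSet_Ioo] using hf0
  calc ENNReal.ofReal (∫ t in a..b, f t) * v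
      = (∫⁻ t in Set.Ioo a b, ENNReal.ofReal (f t)) * v := by
        rw [intervalIntegral.integral_of_le hab, integral_Ioc_eq_integral_Ioo,
          ofReal_integral_eq_lintegral_ofReal hint hnonneg]
    _ = ∫⁻ t in Set.Ioo a b, ENNReal.ofReal (f t) * v :=
        (lintegral_mul_const _ (by fun_prop)).symm
    _ ≤ ∫⁻ t in Set.Ioo a b, g t := setLIntegral_mono' measurableSet_Ioo hfg

lemma integral_mul_div_pow (hh : 0 < h) :
    ∫ t in (0 : ℝ)..h, (r * t / h) ^ m = r ^ m * (h / (m + 1)) := by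
  have hcongr : ∀ t : ℝ, (r * t / h) ^ m = (r / h) ^ m * t ^ m := fun t => by
    rw [← mul_pow]
    ring
  simp only [hcongr, intervalIntegral.integral_const_mul, integral_pow, div_pow]
  field_simp
  ring

lemma integral_mul_sqrt_one_sub_sq_pow (hr : 0 ≤ r) (hhr : h ^ 2 + r ^ 2 = 1) :
    ∫ t in h..1, t * √(1 - t ^ 2) ^ m = r ^ (m + 2) / (m + 2) := by
  obtain ⟨hh', hh⟩ : -1 ≤ h ∧ h ≤ 1 := abs_le.1 (abs_le_one_iff_mul_self_le_one.2 (by nlinarith))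
  have hderiv : ∀ t ∈ Set.Ioo h 1, HasDerivAt (fun t : ℝ => -(√(1 - t ^ 2) ^ (m + 2) / (m + 2)))
      (t * √(1 - t ^ 2) ^ m) t := fun t ht => by
    have hpos : 0 < 1 - t ^ 2 := by nlinarith [ht.1, ht.2]
    have : 0 < √(1 - t ^ 2) := Real.sqrt_pos.2 hpos
    have hinner : HasDerivAt (fun t : ℝ => 1 - t ^ 2) (-(2 * t)) t := by
      simpa using (hasDerivAt_pow 2 t).const_sub 1
    refine HasDerivAt.congr_deriv
      (((hinner.sqrt hpos.ne').pow (m + 2)).div_const ((m : ℝ) + 2)).neg ?_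
    push_cast
    rw [pow_succ]
    field_simp
  rw [intervalIntegral.integral_eq_sub_of_hasDerivAt_of_le hh (by fun_prop) hderiv
    (Continuous.intervalIntegrable (by fun_prop) _ _)]
  have hr2 : 1 - h ^ 2 = r ^ 2 := by linarith
  simp [hr2, Real.sqrt_sq hr]

lemma ofReal_mul_volume_ball_le_volume_circularCone (hc : ‖c‖ = 1)
    (hm : finrank ℝ (ℝ ∙ c)ᗮ = m) (hh : 0 < h) (hr : 0 < r) (hhr : h ^ 2 + r ^ 2 = 1) :
    ENNReal.ofReal (r ^ m * (h / (m + 1)) + r ^ (m + 2) / (m + 2)) *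
      volume (ball (0 : (ℝ ∙ c)ᗮ) 1) ≤ volume (circularCone c h ∩ ball 0 1) := by
  set v := volume (ball (0 : (ℝ ∙ c)ᗮ) 1)
  set slice : ℝ → Set (ℝ ∙ c)ᗮ := fun t => {z | t • c + (z : V) ∈ circularCone c h ∩ ball 0 1}
  have hball : ∀ ρ : ℝ, 0 < ρ → volume (ball (0 : (ℝ ∙ c)ᗮ) ρ) = ENNReal.ofReal (ρ ^ m) * v :=
    fun ρ hρ => hm ▸ Measure.addHaar_ball_of_pos volume _ hρ
  have hlow : ENNReal.ofReal (r ^ m * (h / (m + 1))) * v ≤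
      ∫⁻ t in Set.Ioo 0 h, volume (slice t) := by
    rw [← integral_mul_div_pow hh]
    refine ofReal_integral_mul_le_setLIntegral hh.le (by fun_prop) (fun t ht => ?_) fun t ht => ?_
    all_goals have hpos : 0 < r * t / h := div_pos (mul_pos hr ht.1) hh
    · positivity
    · rw [← hball _ hpos]
      exact measure_mono (ball_subset_slice_of_lt hc hr hhr ht)
  -- The factor `t ≤ 1` is inserted to obtain an elementary integral.
  have hhigh : ENNReal.ofReal (r ^ (m + 2) / (m + 2)) * v ≤
      ∫⁻ t in Set.Ioo h 1, volume (slice t) := by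
    rw [← integral_mul_sqrt_one_sub_sq_pow hr.le hhr]
    refine ofReal_integral_mul_le_setLIntegral (by nlinarith) (by fun_prop)
      (fun t ht => mul_nonneg (hh.trans ht.1).le (by positivity)) fun t ht => ?_
    have hpos : 0 < √(1 - t ^ 2) := Real.sqrt_pos.2 (by nlinarith [ht.1, ht.2])
    calc ENNReal.ofReal (t * √(1 - t ^ 2) ^ m) * v
        ≤ ENNReal.ofReal (√(1 - t ^ 2) ^ m) * v := by
          gcongr
          exact mul_le_of_le_one_left (by positivity) ht.2.le
      _ = volume (ball (0 : (ℝ ∙ c)ᗮ) √(1 - t ^ 2)) := (hball _ hpos).symm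
      _ ≤ volume (slice t) := measure_mono (ball_subset_slice_of_gt hc hh hr hhr ht.1)
  have hdisj : Disjoint (Set.Ioo 0 h) (Set.Ioo h 1) :=
    Set.disjoint_left.2 fun t ht ht' => lt_asymm ht.2 ht'.1
  calc ENNReal.ofReal (r ^ m * (h / (m + 1)) + r ^ (m + 2) / (m + 2)) * v
      ≤ (∫⁻ t in Set.Ioo 0 h, volume (slice t)) + ∫⁻ t in Set.Ioo h 1, volume (slice t) := by
        rw [ENNReal.ofReal_add (by positivity) (by positivity), add_mul]
        exact add_le_add hlow hhigh
    _ = ∫⁻ t in Set.Ioo 0 h ∪ Set.Ioo h 1, volume (slice t) :=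
        (lintegral_union measurableSet_Ioo hdisj).symm
    _ ≤ ∫⁻ t, volume (slice t) := setLIntegral_le_lintegral _ _
    _ = volume (circularCone c h ∩ ball 0 1) := (volume_eq_lintegral_slice hc
        ((isOpen_circularCone c h).inter isOpen_ball).measurableSet).symm

end ConeVolume

section BallVolume

variable {F V : Type*} [NormedAddCommGroup F] [InnerProductSpace ℝ F] [FiniteDimensional ℝ F]
  [MeasurableSpace F] [BorelSpace F] [NormedAddCommGroup V] [InnerProductSpace ℝ V]
  [FiniteDimensional ℝ V] [MeasurableSpace V] [BorelSpace V]

lemma sqrt_mul_Gamma_add_half_le {x : ℝ} (hx : 0 < x) :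
    √x * Real.Gamma (x + 1 / 2) ≤ Real.Gamma (x + 1) := by
  have hconv := Real.Gamma_mul_add_mul_le_rpow_Gamma_mul_rpow_Gamma (s := x) (t := x + 1)
    (a := 1 / 2) (b := 1 / 2) hx (by linarith) (by norm_num) (by norm_num) (by norm_num)
  rw [show 1 / 2 * x + 1 / 2 * (x + 1) = x + 1 / 2 by ring, ← Real.sqrt_eq_rpow,
    ← Real.sqrt_eq_rpow] at hconv
  calc √x * Real.Gamma (x + 1 / 2) ≤ √x * (√(Real.Gamma x) * √(Real.Gamma (x + 1))) := by gcongr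
    _ = √(x * Real.Gamma x) * √(Real.Gamma (x + 1)) := by rw [Real.sqrt_mul hx.le, mul_assoc]
    _ = Real.Gamma (x + 1) := by
      rw [← Real.Gamma_add_one hx.ne', Real.mul_self_sqrt (Real.Gamma_pos_of_pos (by linarith)).le]

lemma volume_real_ball_zero_one (F : Type*) [NormedAddCommGroup F] [InnerProductSpace ℝ F]
    [FiniteDimensional ℝ F] [MeasurableSpace F] [BorelSpace F] :
    volume.real (ball (0 : F) 1) =
      √Real.pi ^ finrank ℝ F / Real.Gamma (finrank ℝ F / 2 + 1) := by
  have : 0 < Real.Gamma ((finrank ℝ F : ℝ) / 2 + 1) := Real.Gamma_pos_of_pos (by positivity)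
  rcases subsingleton_or_nontrivial F with hF | hF
  · set e := stdOrthonormalBasis ℝ F
    have hball : ball (0 : F) 1 = parallelepiped e :=
      (Set.Nonempty.eq_univ ⟨0, by simp⟩).trans
        (((Set.nonempty_Icc.2 zero_le_one).image _).eq_univ).symm
    rw [Measure.real, hball, e.volume_parallelepiped, finrank_zero_of_subsingleton]
    simp
  · rw [Measure.real, InnerProductSpace.volume_ball, ENNReal.ofReal_one, one_pow, one_mul,
      ENNReal.toReal_ofReal (by positivity)]

lemma sqrt_mul_volume_real_ball_le (h : finrank ℝ V = finrank ℝ F + 1) :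
    √(finrank ℝ V / (2 * Real.pi)) * volume.real (ball (0 : V) 1) ≤
      volume.real (ball (0 : F) 1) := by
  rw [volume_real_ball_zero_one, volume_real_ball_zero_one, h]
  set m := finrank ℝ F
  push_cast
  have hx : (0 : ℝ) < (m + 1) / 2 := by positivity
  have hGamma := sqrt_mul_Gamma_add_half_le hx
  rw [show ((m : ℝ) + 1) / 2 + 1 / 2 = m / 2 + 1 by ring] at hGamma
  have hm : 0 < Real.Gamma ((m : ℝ) / 2 + 1) := Real.Gamma_pos_of_pos (by positivity)
  have hm' : 0 < Real.Gamma (((m : ℝ) + 1) / 2 + 1) := Real.Gamma_pos_of_pos (by positivity)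
  have : 0 < √Real.pi := Real.sqrt_pos.2 Real.pi_pos
  calc √((m + 1) / (2 * Real.pi)) * (√Real.pi ^ (m + 1) / Real.Gamma ((m + 1) / 2 + 1))
      = √Real.pi ^ m * (√((m + 1) / 2) / Real.Gamma ((m + 1) / 2 + 1)) := by
        rw [← div_div, Real.sqrt_div hx.le, pow_succ]
        field_simp
    _ ≤ √Real.pi ^ m * (1 / Real.Gamma (m / 2 + 1)) := by
        gcongr ?_ * ?_
        rw [div_le_div_iff₀ hm' hm]
        linarith
    _ = √Real.pi ^ m / Real.Gamma (m / 2 + 1) := mul_one_div _ _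

/-- The uniform probability measure on the unit ball. -/
noncomputable def ballMeasure (V : Type*) [NormedAddCommGroup V] [InnerProductSpace ℝ V]
    [FiniteDimensional ℝ V] [MeasurableSpace V] [BorelSpace V] : Measure V :=
  ProbabilityTheory.cond volume (ball (0 : V) 1)

instance isProbabilityMeasure_ballMeasure : IsProbabilityMeasure (ballMeasure V) :=
  ProbabilityTheory.cond_isProbabilityMeasure_of_finite (measure_ball_pos _ _ one_pos).ne'
    measure_ball_lt_top.ne

lemma volume_real_ball_zero_one_pos : 0 < volume.real (ball (0 : V) 1) :=
  ENNReal.toReal_pos (measure_ball_pos _ _ one_pos).ne' measure_ball_lt_top.ne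

lemma ballMeasure_real_apply (S : Set V) :
    (ballMeasure V).real S = volume.real (ball 0 1 ∩ S) / volume.real (ball (0 : V) 1) := by
  rw [ballMeasure, Measure.real, ProbabilityTheory.cond_apply measurableSet_ball,
    ENNReal.toReal_mul, ENNReal.toReal_inv, inv_mul_eq_div]
  rfl

lemma measurePreserving_ballMeasure (σ : V ≃ₗᵢ[ℝ] V) :
    MeasurePreserving σ (ballMeasure V) (ballMeasure V) := by
  have hpre : σ ⁻¹' ball 0 1 = ball 0 1 := by simp
  have := (σ.measurePreserving.restrict_preimage (measurableSet_ball (x := (0 : V)) (ε := 1)))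
  rw [hpre] at this
  exact this.smul_measure _

lemma le_ballMeasure_circularCone {c : V} {h r : ℝ} {m : ℕ} (hc : ‖c‖ = 1)
    (hm : finrank ℝ V = m + 1) (hh : 0 < h) (hr : 0 < r) (hhr : h ^ 2 + r ^ 2 = 1) :
    √((m + 1) / (2 * Real.pi)) * (r ^ m * (h / (m + 1)) + r ^ (m + 2) / (m + 2)) ≤
      (ballMeasure V).real (circularCone c h) := by
  have hcm : finrank ℝ (ℝ ∙ c)ᗮ = m :=
    haveI : Fact (finrank ℝ V = m + 1) := ⟨hm⟩
    Submodule.finrank_orthogonal_span_singleton (norm_ne_zero_iff.1 (by simp [hc]))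
  set C := r ^ m * (h / (m + 1)) + r ^ (m + 2) / (m + 2)
  have hC : 0 ≤ C := by positivity
  have hcone : C * volume.real (ball (0 : (ℝ ∙ c)ᗮ) 1) ≤
      volume.real (ball 0 1 ∩ circularCone c h) := by
    rw [Set.inter_comm, Measure.real, ← ENNReal.toReal_ofReal hC, ← ENNReal.toReal_mul]
    exact ENNReal.toReal_mono
      (measure_ne_top_of_subset Set.inter_subset_right measure_ball_lt_top.ne)
      (ofReal_mul_volume_ball_le_volume_circularCone hc hcm hh hr hhr)
  have hball := sqrt_mul_volume_real_ball_le (F := (ℝ ∙ c)ᗮ) (V := V) (by rw [hm, hcm])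
  rw [hm] at hball
  push_cast at hball
  rw [ballMeasure_real_apply, le_div_iff₀ volume_real_ball_zero_one_pos, mul_right_comm, mul_comm]
  exact (mul_le_mul_of_nonneg_left hball hC).trans hcone

lemma le_ballMeasure_strictDualCone {X : Set V} {D : ℝ} {m : ℕ} (hm : finrank ℝ V = m + 1)
    (hX : ∀ u ∈ X, ‖u‖ = 1) (hD0 : 0 < D) (hD : D ^ 2 < 2)
    (hXD : ∀ u ∈ X, ∀ v ∈ X, ‖u - v‖ ≤ D) :
    √((m + 1) / (2 * Real.pi)) * (coneSin D ^ m * (coneCos D / (m + 1)) +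
      coneSin D ^ (m + 2) / (m + 2)) / 2 ≤ (ballMeasure V).real (strictDualCone X) := by
  have : Nontrivial V := nontrivial_of_finrank_pos (R := ℝ) (by lia)
  obtain ⟨c, hc, hcX⟩ := exists_unit_sqrt_le_inner (b := 1 - D ^ 2 / 2) (by linarith)
    fun u hu v hv => le_inner_of_norm_sub_le (hX u hu) (hX v hv) (hXD u hu v hv)
  set σ := (ℝ ∙ c).reflection
  have hcover : circularCone c (coneCos D) ⊆ strictDualCone X ∪ σ ⁻¹' strictDualCone X :=
    fun y hy => mem_strictDualCone_or_reflection_mem hc hD0 hD hXD hcX hy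
  have hcone := le_ballMeasure_circularCone hc hm (coneCos_pos hD0 hD) (coneSin_pos hD)
    (coneCos_sq_add_coneSin_sq hD)
  have hσ := (measurePreserving_ballMeasure σ).measureReal_preimage
    (measurableSet_strictDualCone X).nullMeasurableSet
  linarith [(measureReal_mono hcover).trans (measureReal_union_le (μ := ballMeasure V) _ _)]

end BallVolume

section Net

variable {V : Type*} [NormedAddCommGroup V] [NormedSpace ℝ V] [FiniteDimensional ℝ V] {A : Set V}
  {x₀ : V} {r : NNReal} {R : ℝ}

lemma card_le_of_isSeparated {S : Finset V} (hr : 0 < r) (hR : 0 ≤ R)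
    (hS : (S : Set V) ⊆ closedBall x₀ R) (hsep : IsSeparated r (S : Set V)) :
    (S.card : ℝ) ≤ (1 + 2 * R / r) ^ finrank ℝ V := by
  borelize V
  let μ : Measure V := Measure.addHaar
  have hr2 : (0 : ℝ) < r / 2 := by positivity
  have hdisj : (S : Set V).Pairwise (Function.onFun Disjoint fun s => ball s (r / 2)) := by
    intro s hs t ht hst
    have hlt : (r : ℝ) < dist s t := by
      have hlt : (r : ENNReal) < edist s t := hsep hs ht hst
      rw [edist_nndist] at hlt
      exact_mod_cast hlt
    exact ball_disjoint_ball (by linarith)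
  have hsub : (⋃ s ∈ S, ball s (r / 2)) ⊆ ball x₀ (r / 2 + R) :=
    Set.iUnion₂_subset fun s hs => ball_subset_ball' (by linarith [mem_closedBall.1 (hS hs)])
  have hvol := measureReal_mono (μ := μ) hsub measure_ball_lt_top.ne
  rw [measureReal_biUnion_finset hdisj fun _ _ => measurableSet_ball] at hvol
  simp only [measureReal_def, μ.addHaar_ball_of_pos _ hr2,
    μ.addHaar_ball_of_pos x₀ (by positivity : 0 < r / 2 + R), ENNReal.toReal_mul,
    Finset.sum_const, nsmul_eq_mul, ← mul_assoc] at hvol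
  rw [ENNReal.toReal_ofReal (by positivity), ENNReal.toReal_ofReal (by positivity)] at hvol
  have hball : 0 < (μ (ball 0 1)).toReal :=
    ENNReal.toReal_pos (measure_ball_pos μ 0 one_pos).ne' measure_ball_lt_top.ne
  rw [show 1 + 2 * R / r = (r / 2 + R) / (r / 2) by field_simp, div_pow,
    le_div_iff₀ (by positivity)]
  exact le_of_mul_le_mul_right hvol hball

lemma packingNumber_le_floor (hr : 0 < r) (hR : 0 ≤ R) (hA : A ⊆ closedBall x₀ R) :
    packingNumber r A ≤ ⌊(1 + 2 * R / r) ^ finrank ℝ V⌋₊ := by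
  refine iSup_le fun C => iSup₂_le fun hCA hC => ?_
  by_contra! hlt
  obtain ⟨S, hSC, hS⟩ := Set.exists_subset_encard_eq (Order.add_one_le_of_lt hlt)
  lift S to Finset V using Set.finite_of_encard_eq_coe hS
  have hcard := card_le_of_isSeparated hr hR ((hSC.trans hCA).trans hA) (hC.subset hSC)
  rw [Set.encard_coe_eq_coe_finsetCard] at hS
  norm_cast at hS
  exact absurd (Nat.le_floor hcard) (by lia)

lemma exists_finset_isCover (hr : 0 < r) (hR : 0 ≤ R) (hA : A ⊆ closedBall x₀ R) :
    ∃ S : Finset V, IsCover r A S ∧ (S.card : ℝ) ≤ (1 + 2 * R / r) ^ finrank ℝ V := by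
  have hpack := packingNumber_le_floor hr hR hA
  have htop : packingNumber r A ≠ ⊤ := ne_top_of_le_ne_top (ENat.natCast_ne_top _) hpack
  rw [← encard_maximalSeparatedSet htop] at hpack
  obtain ⟨S, hS⟩ := (Set.finite_of_encard_le_coe hpack).exists_finset_coe
  rw [← hS, Set.encard_coe_eq_coe_finsetCard] at hpack
  refine ⟨S, hS ▸ isCover_maximalSeparatedSet htop, ?_⟩
  exact (Nat.cast_le.2 (by exact_mod_cast hpack)).trans (Nat.floor_le (by positivity))

end Net

section HittingSet

variable {Ω ι : Type*} [MeasurableSpace Ω] {μ : Measure Ω} [IsProbabilityMeasure μ]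
  {A : ι → Set Ω} {J : Finset ι} {p L : ℝ}

open scoped Classical in
lemma exists_mul_card_le_card_filter_mem (hA : ∀ i ∈ J, MeasurableSet (A i))
    (hp : ∀ i ∈ J, p ≤ μ.real (A i)) :
    ∃ y, p * J.card ≤ (J.filter fun i => y ∈ A i).card := by
  have hint : ∀ i ∈ J, Integrable ((A i).indicator (1 : Ω → ℝ)) μ := fun i hi =>
    (integrable_const 1).indicator (hA i hi)
  obtain ⟨y, hy⟩ := exists_integral_le (μ := μ) (integrable_finsetSum J hint)
  refine ⟨y, ?_⟩
  calc p * J.card = ∑ _i ∈ J, p := by rw [Finset.sum_const, nsmul_eq_mul, mul_comm]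
    _ ≤ ∑ i ∈ J, μ.real (A i) := Finset.sum_le_sum hp
    _ = ∫ x, ∑ i ∈ J, (A i).indicator (1 : Ω → ℝ) x ∂μ := by
        rw [integral_finsetSum J hint]
        exact Finset.sum_congr rfl fun i hi => (integral_indicator_one (hA i hi)).symm
    _ ≤ ∑ i ∈ J, (A i).indicator (1 : Ω → ℝ) y := hy
    _ = (J.filter fun i => y ∈ A i).card := by
        rw [Finset.card_filter]
        push_cast
        exact Finset.sum_congr rfl fun i _ => by simp [Set.indicator_apply]

open scoped Classical in
lemma exists_card_le_card_filter_forall_notMem_le (hA : ∀ i ∈ J, MeasurableSet (A i))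
    (hp : ∀ i ∈ J, p ≤ μ.real (A i)) (hp1 : p ≤ 1) (k : ℕ) :
    ∃ Y : Finset Ω, Y.card ≤ k ∧
      ((J.filter fun i => ∀ y ∈ Y, y ∉ A i).card : ℝ) ≤ (1 - p) ^ k * J.card := by
  induction k with
  | zero => exact ⟨∅, by simp⟩
  | succ k ih =>
    obtain ⟨Y, hY, hcard⟩ := ih
    set J' := J.filter fun i => ∀ y ∈ Y, y ∉ A i
    obtain ⟨y, hy⟩ := exists_mul_card_le_card_filter_mem (μ := μ) (J := J') (p := p)
      (fun i hi => hA i (Finset.filter_subset _ _ hi))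
      (fun i hi => hp i (Finset.filter_subset _ _ hi))
    have hsplit : ((J'.filter fun i => y ∈ A i).card : ℝ) +
        (J'.filter fun i => y ∉ A i).card = J'.card := by
      exact_mod_cast Finset.card_filter_add_card_filter_not (s := J') (p := fun i => y ∈ A i)
    have hmissed : (J.filter fun i => ∀ x ∈ insert y Y, x ∉ A i) = J'.filter fun i => y ∉ A i := by
      ext i
      simp only [J', Finset.mem_filter, Finset.forall_mem_insert]
      tauto
    refine ⟨insert y Y, (Finset.card_insert_le _ _).trans (by lia), ?_⟩
    calc ((J.filter fun i => ∀ x ∈ insert y Y, x ∉ A i).card : ℝ)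
        ≤ (1 - p) * J'.card := by rw [hmissed]; linarith
      _ ≤ (1 - p) * ((1 - p) ^ k * J.card) := mul_le_mul_of_nonneg_left hcard (by linarith)
      _ = (1 - p) ^ (k + 1) * J.card := by ring

lemma exists_hitting_finset (hA : ∀ i ∈ J, MeasurableSet (A i))
    (hp : ∀ i ∈ J, p ≤ μ.real (A i)) (hp0 : 0 < p) (hp1 : p ≤ 1) (hL : 0 ≤ L)
    (hJ : (J.card : ℝ) ≤ Real.exp L) :
    ∃ Y : Finset Ω, (Y.card : ℝ) ≤ L / p + 1 ∧ ∀ i ∈ J, ∃ y ∈ Y, y ∈ A i := by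
  classical
  obtain ⟨Y, hY, hcard⟩ :=
    exists_card_le_card_filter_forall_notMem_le hA hp hp1 (⌊L / p⌋₊ + 1)
  set k := ⌊L / p⌋₊ + 1
  have hk : L < p * k := by
    have := Nat.lt_floor_add_one (L / p)
    rw [div_lt_iff₀' hp0] at this
    exact_mod_cast this
  have hmissed : ((J.filter fun i => ∀ y ∈ Y, y ∉ A i).card : ℝ) < 1 :=
    calc ((J.filter fun i => ∀ y ∈ Y, y ∉ A i).card : ℝ)
        ≤ (1 - p) ^ k * J.card := hcard
      _ ≤ Real.exp (-p) ^ k * Real.exp L := by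
          gcongr
          exact Real.one_sub_le_exp_neg p
      _ = Real.exp (L - p * k) := by
          rw [← Real.exp_nat_mul, ← Real.exp_add]
          ring_nf
      _ < 1 := Real.exp_lt_one_iff.2 (by linarith)
  refine ⟨Y, ?_, fun i hi => ?_⟩
  · calc (Y.card : ℝ) ≤ k := by exact_mod_cast hY
      _ ≤ L / p + 1 := by
          push_cast [k]
          linarith [Nat.floor_le (by positivity : 0 ≤ L / p)]
  · have hempty : (J.filter fun i => ∀ y ∈ Y, y ∉ A i) = ∅ :=
      Finset.card_eq_zero.1 (Nat.lt_one_iff.1 (by exact_mod_cast hmissed))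
    simpa using Finset.filter_eq_empty_iff.1 hempty hi

end HittingSet

section Estimates

-- A set of unit vectors of diameter `1` gives a cone with cosine `√(1 / 3)` and sine `√(2 / 3)`.
-- Diameter `1 + 2 / (25 * n)` costs the sine at most a factor `1 - 13 / (200 * n)`, and hence its
-- `n`-th power at most a constant factor.

variable {x c s D : ℝ} {m n : ℕ}

lemma sqrt_one_third_le_coneCos (hD1 : 1 ≤ D) (hD : D ^ 2 < 2) : √(1 / 3) ≤ coneCos D := by
  have hD0 : 0 < D := by linarith
  rw [coneCos, ← Real.sqrt_sq hD0.le, Real.sq_sqrt (sq_nonneg D), ← Real.sqrt_div (sq_nonneg D)]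
  refine Real.sqrt_le_sqrt ?_
  rw [div_le_div_iff₀ (by norm_num) (by linarith)]
  nlinarith

lemma sqrt_two_thirds_mul_le_coneSin (hx0 : 0 ≤ x) (hx1 : x ≤ 1) :
    √(2 / 3) * (1 - 13 / 200 * x) ≤ coneSin (1 + 2 / 25 * x) := by
  have hpos : 0 < 4 - (1 + 2 / 25 * x) ^ 2 := by nlinarith
  rw [coneSin, ← Real.sqrt_div' _ hpos.le]
  refine Real.le_sqrt_of_sq_le ?_
  rw [mul_pow, Real.sq_sqrt (by norm_num), le_div_iff₀ hpos]
  nlinarith [pow_nonneg hx0 2, pow_nonneg hx0 3, mul_nonneg hx0 (sub_nonneg.2 hx1),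
    mul_nonneg (pow_nonneg hx0 2) (sub_nonneg.2 hx1),
    mul_nonneg (pow_nonneg hx0 3) (sub_nonneg.2 hx1)]

lemma le_sqrt_mul_one_sub_pow_add (m : ℕ) :
    866 / 1000 ≤ √(1 / 3) * (1 - 13 / 200 * (1 / ((m : ℝ) + 1))) ^ m +
      2 / 3 * (1 - 13 / 200 * (1 / ((m : ℝ) + 1))) ^ (m + 2) * ((m + 1) / (m + 2)) := by
  have hy1 : 1 / ((m : ℝ) + 1) ≤ 1 :=
    (div_le_one (by positivity)).2 (by linarith [m.cast_nonneg (α := ℝ)])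
  have : 0 ≤ 1 / ((m : ℝ) + 1) := by positivity
  set y := 13 / 200 * (1 / ((m : ℝ) + 1)) with hy
  have hym : (m : ℝ) * y = 13 / 200 - y := by
    rw [hy]
    field_simp
    ring
  have hpow : ∀ k : ℕ, 1 - k * y ≤ (1 - y) ^ k := fun k => by
    simpa [sub_eq_add_neg] using one_add_mul_le_pow (a := -y) (by linarith) k
  have hlow : 187 / 200 + y ≤ (1 - y) ^ m := by linarith [hpow m]
  have hhigh : 187 / 200 - y ≤ (1 - y) ^ (m + 2) := by
    have := hpow (m + 2)
    push_cast at this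
    linarith
  have hsqrt : (577 / 1000 : ℝ) ≤ √(1 / 3) := Real.le_sqrt_of_sq_le (by norm_num)
  calc (866 / 1000 : ℝ)
      ≤ 577 / 1000 * (187 / 200 + y) + 2 / 3 * (187 / 200 - y) * ((m + 1) / (m + 2)) := by
        have : (0 : ℝ) ≤ m := m.cast_nonneg
        rw [hy]
        field_simp
        nlinarith
    _ ≤ _ := by gcongr

lemma pow_mul_le_pow_mul_add_pow_div (hc : √(1 / 3) ≤ c)
    (hs : √(2 / 3) * (1 - 13 / 200 * (1 / (m + 1))) ≤ s) :
    √(2 / 3) ^ m * (866 / 1000 / (m + 1)) ≤ s ^ m * (c / (m + 1)) + s ^ (m + 2) / (m + 2) := by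
  have hy1 : 1 / ((m : ℝ) + 1) ≤ 1 :=
    (div_le_one (by positivity)).2 (by linarith [m.cast_nonneg (α := ℝ)])
  have hle := le_sqrt_mul_one_sub_pow_add m
  set z := 1 - 13 / 200 * (1 / ((m : ℝ) + 1)) with hz
  have hz0 : 0 ≤ z := by linarith
  set q := √(2 / 3 : ℝ)
  have hq : q ^ 2 = 2 / 3 := Real.sq_sqrt (by norm_num)
  have hs0 : 0 ≤ s := le_trans (by positivity) hs
  calc q ^ m * (866 / 1000 / (m + 1))
      ≤ q ^ m * ((√(1 / 3) * z ^ m + 2 / 3 * z ^ (m + 2) * ((m + 1) / (m + 2))) / (m + 1)) := by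
        gcongr
    _ = (q * z) ^ m * (√(1 / 3) / (m + 1)) + (q * z) ^ (m + 2) / (m + 2) := by
        rw [← hq, mul_pow, mul_pow]
        field_simp
        ring
    _ ≤ s ^ m * (c / (m + 1)) + s ^ (m + 2) / (m + 2) := by gcongr

lemma mul_sqrt_two_thirds_le_sqrt_inv_two_pi :
    2442 / 5000 * √(2 / 3) ≤ √(1 / (2 * Real.pi)) := by
  refine Real.le_sqrt_of_sq_le ?_
  rw [mul_pow, Real.sq_sqrt (by norm_num), le_div_iff₀ (by positivity)]
  linarith [Real.pi_lt_d4]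

lemma pow_div_sqrt_le_sqrt_mul (hc : √(1 / 3) ≤ c)
    (hs : √(2 / 3) * (1 - 13 / 200 * (1 / (m + 1))) ≤ s) :
    4 / 19 * √(2 / 3) ^ (m + 1) / √(m + 1) ≤
      √((m + 1) / (2 * Real.pi)) * (s ^ m * (c / (m + 1)) + s ^ (m + 2) / (m + 2)) / 2 := by
  have hn : (0 : ℝ) < m + 1 := by positivity
  have hle := pow_mul_le_pow_mul_add_pow_div hc hs
  set q := √(2 / 3 : ℝ)
  calc 4 / 19 * q ^ (m + 1) / √(m + 1)
      ≤ 2442 / 5000 * (866 / 1000) / 2 * q ^ (m + 1) / √(m + 1) := by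
        gcongr ?_ * _ / _
        norm_num
    _ = √(m + 1) * (2442 / 5000 * q) * (q ^ m * (866 / 1000 / (m + 1))) / 2 := by
        rw [div_eq_mul_inv _ √_, ← Real.sqrt_div_self]
        ring
    _ ≤ √(m + 1) * √(1 / (2 * Real.pi)) *
          (s ^ m * (c / (m + 1)) + s ^ (m + 2) / (m + 2)) / 2 := by
        gcongr
        exact mul_sqrt_two_thirds_le_sqrt_inv_two_pi
    _ = √((m + 1) / (2 * Real.pi)) * (s ^ m * (c / (m + 1)) + s ^ (m + 2) / (m + 2)) / 2 := by
        rw [← Real.sqrt_mul hn.le, mul_one_div]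

lemma one_add_fifty_mul_pow_le_exp (hn : 1 ≤ n) :
    (1 + 50 * (n : ℝ)) ^ n ≤ Real.exp (n * (4 + Real.log n)) := by
  have hn' : (1 : ℝ) ≤ n := by exact_mod_cast hn
  have hexp : (51 : ℝ) ≤ Real.exp 4 :=
    calc (51 : ℝ) ≤ 2.7182818283 ^ 4 := by norm_num
      _ ≤ Real.exp 1 ^ 4 := by
        gcongr
        exact Real.exp_one_gt_d9.le
      _ = Real.exp 4 := by
        rw [← Real.exp_nat_mul]
        norm_num
  rw [Real.exp_nat_mul, Real.exp_add, Real.exp_log (by linarith)]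
  gcongr
  nlinarith

lemma three_halves_rpow_half (n : ℕ) : (3 / 2 : ℝ) ^ ((n : ℝ) / 2) = (√(2 / 3) ^ n)⁻¹ := by
  rw [← inv_pow, ← Real.sqrt_inv, Real.sqrt_eq_rpow, ← Real.rpow_mul_natCast (by norm_num)]
  rw [inv_div, one_div_mul_eq_div]

lemma mul_log_div_add_one_le (hn : 1 ≤ n) :
    n * (4 + Real.log n) / (4 / 19 * √(2 / 3) ^ n / √n) + 1 ≤
      5 * (n : ℝ) * √(n : ℝ) * (4 + Real.log (n : ℝ)) * (3 / 2 : ℝ) ^ ((n : ℝ) / 2) := by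
  have hn' : (1 : ℝ) ≤ n := by exact_mod_cast hn
  have hinv : 1 ≤ (√(2 / 3 : ℝ) ^ n)⁻¹ := (one_le_inv₀ (by positivity)).2
    (pow_le_one₀ (by positivity) (Real.sqrt_le_one.2 (by norm_num)))
  have hsqrt : 1 ≤ √(n : ℝ) := Real.one_le_sqrt.2 hn'
  have hlog : 4 ≤ 4 + Real.log n := by linarith [Real.log_nonneg hn']
  have hfour : 4 ≤ (n : ℝ) * √(n : ℝ) * (4 + Real.log n) * (√(2 / 3) ^ n)⁻¹ :=
    calc (4 : ℝ) = 1 * 1 * 4 * 1 := by norm_num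
      _ ≤ _ := by gcongr
  have hdiv : n * (4 + Real.log n) / (4 / 19 * √(2 / 3) ^ n / √n) =
      19 / 4 * ((n : ℝ) * √(n : ℝ) * (4 + Real.log n) * (√(2 / 3) ^ n)⁻¹) := by
    field_simp
  rw [three_halves_rpow_half, hdiv]
  linarith

end Estimates

section ConstantWidth

variable {V : Type*} [NormedAddCommGroup V] [InnerProductSpace ℝ V] {K X : Set V} {w ρ : ℝ}

lemma illuminates_neg {S Y : Set V} (hS : ∀ x ∈ K, ∃ s ∈ S, dist x s ≤ ρ)
    (hY : ∀ s ∈ S, ∃ y ∈ Y, y ∈ strictDualCone (normalsNear K s ρ)) : Illuminates (-Y) K := by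
  intro x hx
  obtain ⟨s, hs, hxs⟩ := hS x hx
  obtain ⟨y, hy, ε, hε, hyε⟩ := hY s hs
  refine ⟨-y, Set.neg_mem_neg.2 hy, fun u hu => ?_⟩
  rw [inner_neg_right]
  linarith [hyε u ⟨x, hx, hxs, hu⟩]

variable [FiniteDimensional ℝ V] [Nontrivial V]

lemma pow_div_sqrt_le_ballMeasure_strictDualCone [MeasurableSpace V] [BorelSpace V]
    (hX : ∀ u ∈ X, ‖u‖ = 1)
    (hXD : ∀ u ∈ X, ∀ v ∈ X, ‖u - v‖ ≤ 1 + 2 * (1 / (25 * finrank ℝ V))) :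
    4 / 19 * √(2 / 3) ^ finrank ℝ V / √(finrank ℝ V) ≤
      (ballMeasure V).real (strictDualCone X) := by
  obtain ⟨m, hm⟩ := Nat.exists_eq_add_one_of_ne_zero (finrank_pos (R := ℝ) (M := V)).ne'
  rw [hm] at hXD ⊢
  push_cast at hXD ⊢
  have hx0 : 0 < 1 / ((m : ℝ) + 1) := by positivity
  have hx1 : 1 / ((m : ℝ) + 1) ≤ 1 :=
    (div_le_one (by positivity)).2 (by linarith [m.cast_nonneg (α := ℝ)])
  have hdiam : 1 + 2 * (1 / (25 * ((m : ℝ) + 1))) = 1 + 2 / 25 * (1 / (m + 1)) := by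
    field_simp
  rw [hdiam] at hXD
  have hD : (1 + 2 / 25 * (1 / ((m : ℝ) + 1))) ^ 2 < 2 := by nlinarith
  exact (pow_div_sqrt_le_sqrt_mul (sqrt_one_third_le_coneCos (by linarith) hD)
    (sqrt_two_thirds_mul_le_coneSin hx0.le hx1)).trans
    (le_ballMeasure_strictDualCone hm hX (by linarith) hD hXD)

lemma exists_net_card_le_exp (hw : 0 < w) (hdiam : ∀ a ∈ K, ∀ b ∈ K, ‖a - b‖ ≤ w) :
    ∃ S : Finset V, (∀ x ∈ K, ∃ s ∈ S, dist x s ≤ w * (1 / (25 * finrank ℝ V))) ∧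
      (S.card : ℝ) ≤ Real.exp (finrank ℝ V * (4 + Real.log (finrank ℝ V))) := by
  rcases K.eq_empty_or_nonempty with rfl | ⟨x₀, hx₀⟩
  · exact ⟨∅, by simp, by simpa using Real.exp_nonneg _⟩
  have hn : 0 < finrank ℝ V := finrank_pos
  have hr : 0 < w * (1 / (25 * finrank ℝ V)) := by positivity
  obtain ⟨S, hS, hcard⟩ := exists_finset_isCover (r := ⟨_, hr.le⟩) hr hw.le
    fun x hx => mem_closedBall_iff_norm.2 (hdiam x hx x₀ hx₀)
  refine ⟨S, fun x hx => ?_, ?_⟩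
  · obtain ⟨s, hs, hxs⟩ := Set.mem_iUnion₂.1 (isCover_iff_subset_iUnion_closedBall.1 hS hx)
    exact ⟨s, hs, hxs⟩
  · calc (S.card : ℝ)
        ≤ (1 + 2 * w / (w * (1 / (25 * finrank ℝ V)))) ^ finrank ℝ V := hcard
      _ = (1 + 50 * finrank ℝ V) ^ finrank ℝ V := by
          congr 1
          field_simp
          ring
      _ ≤ Real.exp (finrank ℝ V * (4 + Real.log (finrank ℝ V))) :=
          one_add_fifty_mul_pow_le_exp hn

lemma exists_finset_illuminates (hw : 0 < w) (hdiam : ∀ a ∈ K, ∀ b ∈ K, ‖a - b‖ ≤ w)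
    (hopp : ∀ x ∈ K, ∀ u ∈ outerNormals K x, x - w • u ∈ K) :
    ∃ Y : Finset V, Illuminates (Y : Set V) K ∧
      (Y.card : ℝ) ≤ 5 * finrank ℝ V * √(finrank ℝ V) * (4 + Real.log (finrank ℝ V)) *
        (3 / 2 : ℝ) ^ ((finrank ℝ V : ℝ) / 2) := by
  classical
  borelize V
  have hn : 0 < finrank ℝ V := finrank_pos
  obtain ⟨S, hS, hScard⟩ := exists_net_card_le_exp hw hdiam
  have hmeasure := fun s => pow_div_sqrt_le_ballMeasure_strictDualCone
    (fun _ => norm_eq_one_of_mem_normalsNear)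
    fun _ hu _ => norm_sub_le_of_mem_normalsNear (s := s) hw hdiam hopp hu
  have := Real.log_natCast_nonneg (finrank ℝ V)
  obtain ⟨Y, hYcard, hY⟩ := exists_hitting_finset (J := S)
    (fun s _ => measurableSet_strictDualCone _) (fun s _ => hmeasure s) (by positivity)
    ((hmeasure 0).trans measureReal_le_one) (by positivity) hScard
  refine ⟨-Y, ?_, ?_⟩
  · rw [Finset.coe_neg]
    exact illuminates_neg hS hY
  · rw [Finset.card_neg]
    exact hYcard.trans (mul_log_div_add_one_le hn)

end ConstantWidth

end Illumination

theorem mainTheorem6 (n : ℕ) (hn : 1 ≤ n) (W : Set (Illumination.E n))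
    (hW : Illumination.IsConstantWidth W) :
    ∃ N : ℕ, Illumination.illuminationNumber W = (N : ℕ∞) ∧
      (N : ℝ) ≤ 5 * (n : ℝ) * Real.sqrt (n : ℝ) * (4 + Real.log (n : ℝ)) *
        (3 / 2 : ℝ) ^ ((n : ℝ) / 2) := by
  have : NeZero n := ⟨by lia⟩
  obtain ⟨w, hw, hdiam, hopp⟩ := hW.exists_diameter
  obtain ⟨Y, hY, hcard⟩ := Illumination.exists_finset_illuminates hw hdiam hopp
  have hle := hW.isConvexBody.illuminationNumber_le_encard hY
  rw [Set.encard_coe_eq_coe_finsetCard] at hle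
  obtain ⟨N, hN, hNY⟩ := ENat.le_natCast_iff.1 hle
  rw [finrank_euclideanSpace_fin] at hcard
  exact ⟨N, hN, (Nat.cast_le.2 hNY).trans hcard⟩
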